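/- **Conventions.** For $\varphi\colon H\to[-\infty,+\infty]$ on a finite-dimensional real inner product space $H$, $\partial\varphi$ is the limiting (Mordukhovich) subdifferential, and $N_C$ is the limiting normal cone of a set $C$. The function $\varphi$ is *prox-regular at $x_0$ for $v_0$ with respect to $\varepsilon>0$ and $\rho\ge 0$* if $\varphi$ is finite and locally l.s.c. at $x_0$, $v_0\in\partial\varphi(x_0)$, and $$\varphi(y)\ \ge\ \varphi(x)+\langle v,y-x\rangle-\tfrac{\rho}{2}\|y-x\|^2\quad\text{for all }y\text{ with }\|y-x_0\|\le\varepsilon$$ whenever $v\in\partial\varphi(x)$, $\|v-v_0\|<\varepsilon$, $\|x-x_0\|<\varepsilon$ and $\varphi(x)<\varphi(x_0)+\varepsilon$. It is *prox-regular at $x_0$ for $v_0$* if this holds for some $\varepsilon>0$, $\rho\ge0$. A set $C$ is prox-regular at $x_0\in C$ for $w_0\in N_C(x_0)$ if its indicator function $\delta_C$ is. The *$\varphi$-attentive $\delta$-localization* of $\partial\varphi$ around $(x_0,v_0)$ is the mapping $T$ with $T(x)=\{v\in\partial\varphi(x):\|v-v_0\|<\delta\}$ if $\|x-x_0\|<\delta$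 and $|\varphi(x)-\varphi(x_0)|<\delta$, and $T(x)=\emptyset$ otherwise. A set-valued mapping $T$ is *monotone* if $\langle v_1-v_0,x_1-x_0\rangle\ge0$ whenever $v_i\in T(x_i)$. **Setting.** Let $f\colon\mathbb R^n\to[-\infty,+\infty]$, $\bar x\in\mathbb R^n$, let $\mathcal V$ be a linear subspace of $\mathbb R^n$, $\mathcal U=\mathcal V^\perp$, and write $x_u$, $x_v$ for the orthogonal projections of $x$ onto $\mathcal U$, $\mathcal V$. Let $B_{\mathcal V}(0,\epsilon)$ be the closed $\epsilon$-ball of $\mathcal V$. Let $\epsilon>0$ and let $\bar g\in\mathbb R^n$ be such that $\bar g+v\in\partial f(\bar x)$ for all $v\in\mathcal V$ with $\|v\|<\epsilon$. For $u\in\mathcal U$ put $$L_\epsilon(u;\bar g_v)=\inf_{v\in B_{\mathcal V}(0,\epsilon)}\{f(\bar x+u+v)-\langle\bar g_v,v\rangle\},\qquad W(u;\bar g_v)=\operatorname*{argmin}_{v\in B_{\mathcal V}(0,\epsilon)}\{f(\bar x+u+v)-\langle\bar g_v,v\rangle\}.$$ **Assumption 1.** $f$ is proper and l.s.c. and is properly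 prox-regular at $\bar x$ with respect to $\bar\epsilon$ and $\rho$: for every $g\in\partial f(\bar x)$, $f$ is prox-regular at $\bar x$ for $g$ with respect to $\bar\epsilon$ and $\rho$; and for every $g$ with $(g,-1)\in N_{\operatorname{epi}f}(\bar x,f(\bar x))$, the set $\operatorname{epi}f$ is prox-regular at $(\bar x,f(\bar x))$ for $(g,-1)$. **Assumption 2.** $0<\rho<2$ and $\bar\epsilon>\epsilon$. **Assumption 3.** With $r=\sqrt{\bar\epsilon-\epsilon}$ and $\Theta=\{u\in\mathcal U:\|u\|<r,\ |L_\epsilon(u;\bar g_v)-f(\bar x)|<r\}$, there is a constant $c\ge0$ such that $\|v_1-v_2\|\le c\|u_1-u_2\|$ for all $u_1,u_2\in\Theta$ and all $v_i\in W(u_i;\bar g_v)$, $i=1,2$. **Theorem.** Under Assumptions 1–3, the function $L_\epsilon(\cdot\,;\bar g_v)$ on $\mathcal U$ is prox-regular at $0$ for $\bar g_u$. Moreover, for some $\delta>0$, the $L_\epsilon$-attentive $\delta$-localization $S$ of $\partial L_\epsilon(\cdot\,;\bar g_v)$ around $(0,\bar g_u)$ is such that $S+\rho(1+c^2)I$ is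 monotone. -/

import Mathlib

open Filter Topology

noncomputable section

section VariationalAnalysis

variable {H : Type*} [NormedAddCommGroup H] [InnerProductSpace ℝ H]

/-- An extended-real-valued function is proper if it never takes the value `-∞` and is not
identically `+∞`. -/
def IsProperFun (f : H → EReal) : Prop :=
  (∀ x, f x ≠ ⊥) ∧ ∃ x, f x ≠ ⊤

/-- The value `f x` is a real number. -/
def FiniteAt (f : H → EReal) (x : H) : Prop :=
  f x ≠ ⊥ ∧ f x ≠ ⊤

/-- `|a - b| < r` for extended reals `a` and `b`; it is false unless both are finite. -/
def EClose (a b : EReal) (r : ℝ) : Prop :=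
  b - (r : EReal) < a ∧ a < b + (r : EReal)

/-- Local lower semicontinuity at a point where `f` is finite: for some `δ > 0` all the sets
`{x ∈ B(x₀, δ) | f x ≤ α}` with `α ≤ f x₀ + δ` are closed. -/
def LocallyLscAt (f : H → EReal) (x₀ : H) : Prop :=
  FiniteAt f x₀ ∧ ∃ δ : ℝ, 0 < δ ∧ ∀ α : ℝ, (α : EReal) ≤ f x₀ + (δ : EReal) →
    IsClosed {x | x ∈ Metric.closedBall x₀ δ ∧ f x ≤ (α : EReal)}

/-- The regular (Frechet) subdifferential: `v` such that `f` is finite at `x` and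
`f y ≥ f x + ⟨v, y - x⟩ + o(‖y - x‖)`. -/
def regularSubdiff (f : H → EReal) (x : H) : Set H :=
  {v | FiniteAt f x ∧ ∀ η : ℝ, 0 < η → ∀ᶠ y in 𝓝 x,
    f x + ((inner ℝ v (y - x) - η * ‖y - x‖ : ℝ) : EReal) ≤ f y}

/-- The limiting (Mordukhovich) subdifferential: limits of regular subgradients along
sequences `xₖ → x` with `f xₖ → f x`. -/
def limitingSubdiff (f : H → EReal) (x : H) : Set H :=
  {v | FiniteAt f x ∧ ∃ (y : ℕ → H) (w : ℕ → H),
    Tendsto y atTop (𝓝 x) ∧ Tendsto (fun k => f (y k)) atTop (𝓝 (f x)) ∧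
    (∀ k, w k ∈ regularSubdiff f (y k)) ∧ Tendsto w atTop (𝓝 v)}

/-- The regular normal cone to `C` at `x ∈ C`: `⟨v, y - x⟩ ≤ o(‖y - x‖)` for `y ∈ C`. It is
empty if `x ∉ C`. -/
def regularNormalCone (C : Set H) (x : H) : Set H :=
  {v | x ∈ C ∧ ∀ η : ℝ, 0 < η → ∀ᶠ y in 𝓝[C] x, inner ℝ v (y - x) ≤ η * ‖y - x‖}

/-- The limiting normal cone `N_C(x)`. -/
def limitingNormalCone (C : Set H) (x : H) : Set H :=
  {v | x ∈ C ∧ ∃ (y : ℕ → H) (w : ℕ → H),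
    (∀ k, y k ∈ C) ∧ Tendsto y atTop (𝓝 x) ∧
    (∀ k, w k ∈ regularNormalCone C (y k)) ∧ Tendsto w atTop (𝓝 v)}

open Classical in
/-- The indicator function `δ_C` of variational analysis: `0` on `C` and `+∞` off `C`. -/
def indicatorFun (C : Set H) (x : H) : EReal :=
  if x ∈ C then 0 else ⊤

/-- `f` is prox-regular at `x₀` for `v₀` with respect to the constants `ε > 0` and `ρ ≥ 0`. -/
def ProxRegularWith (f : H → EReal) (x₀ v₀ : H) (ε ρ : ℝ) : Prop :=
  0 < ε ∧ 0 ≤ ρ ∧ LocallyLscAt f x₀ ∧ v₀ ∈ limitingSubdiff f x₀ ∧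
    ∀ x v : H, v ∈ limitingSubdiff f x → ‖v - v₀‖ < ε → ‖x - x₀‖ < ε →
      f x < f x₀ + (ε : EReal) →
      ∀ y ∈ Metric.closedBall x₀ ε,
        f x + ((inner ℝ v (y - x) - ρ / 2 * ‖y - x‖ ^ 2 : ℝ) : EReal) ≤ f y

/-- `f` is prox-regular at `x₀` for `v₀`. -/
def ProxRegular (f : H → EReal) (x₀ v₀ : H) : Prop :=
  ∃ ε ρ : ℝ, ProxRegularWith f x₀ v₀ ε ρ

/-- The set `C` is prox-regular at `x₀ ∈ C` for `w₀ ∈ N_C(x₀)`. -/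
def SetProxRegular (C : Set H) (x₀ w₀ : H) : Prop :=
  x₀ ∈ C ∧ w₀ ∈ limitingNormalCone C x₀ ∧ ProxRegular (indicatorFun C) x₀ w₀

/-- The epigraph of `f`, in the Hilbert space product `H × ℝ`. -/
def epigraph (f : H → EReal) : Set (WithLp 2 (H × ℝ)) :=
  {p | f p.fst ≤ ((p.snd : ℝ) : EReal)}

/-- `f` is properly prox-regular at `x₀` with respect to `ε` and `ρ`: with these constants it is
prox-regular at `x₀` for every `g ∈ ∂f(x₀)`, and its epigraph is prox-regular at
`(x₀, f x₀)` for every normal vector there of the form `(g, -1)`. -/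
def ProperlyProxRegularWith (f : H → EReal) (x₀ : H) (ε ρ : ℝ) : Prop :=
  (∀ g ∈ limitingSubdiff f x₀, ProxRegularWith f x₀ g ε ρ) ∧
  ∀ α : ℝ, f x₀ = (α : EReal) → ∀ g : H,
    WithLp.toLp 2 (g, (-1 : ℝ)) ∈ limitingNormalCone (epigraph f) (WithLp.toLp 2 (x₀, α)) →
    SetProxRegular (epigraph f) (WithLp.toLp 2 (x₀, α)) (WithLp.toLp 2 (g, (-1 : ℝ)))

/-- A set-valued mapping `T` is monotone. -/
def MonotoneMapping (T : H → Set H) : Prop :=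
  ∀ x₀ x₁ : H, ∀ v₀ ∈ T x₀, ∀ v₁ ∈ T x₁, 0 ≤ inner ℝ (v₁ - v₀) (x₁ - x₀)

/-- The set-valued mapping `T + σ I`. -/
def addScaledId (T : H → Set H) (σ : ℝ) (x : H) : Set H :=
  (fun v => v + σ • x) '' T x

/-- The `f`-attentive `δ`-localization of `∂f` around `(x₀, v₀)`. -/
def attentiveLocalization (f : H → EReal) (x₀ v₀ : H) (δ : ℝ) (x : H) : Set H :=
  {v | v ∈ limitingSubdiff f x ∧ ‖v - v₀‖ < δ ∧ ‖x - x₀‖ < δ ∧ EClose (f x) (f x₀) δ}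

end VariationalAnalysis

section ULagrangian

variable {n : ℕ}

/-- The set `D_ε f` of all `g` with `g + int B_V(0, ε) ⊆ ∂f(x₀)`. -/
def subgradCore (f : EuclideanSpace ℝ (Fin n) → EReal) (x₀ : EuclideanSpace ℝ (Fin n))
    (V : Submodule ℝ (EuclideanSpace ℝ (Fin n))) (ε : ℝ) : Set (EuclideanSpace ℝ (Fin n)) :=
  {g | ∀ v ∈ V, ‖v‖ < ε → g + v ∈ limitingSubdiff f x₀}

/-- The function minimized over `v ∈ B_V(0, ε)`: `f (x₀ + u + v) - ⟨a, v⟩`. -/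
def tiltedFun (f : EuclideanSpace ℝ (Fin n) → EReal) (x₀ : EuclideanSpace ℝ (Fin n))
    (V : Submodule ℝ (EuclideanSpace ℝ (Fin n))) (a : V) (u : Vᗮ) (v : V) : EReal :=
  f (x₀ + (u : EuclideanSpace ℝ (Fin n)) + (v : EuclideanSpace ℝ (Fin n))) -
    ((inner ℝ a v : ℝ) : EReal)

/-- The `U`-Lagrangian `L_ε(u; a)`, on `U = Vᗮ`. -/
def uLagrangian (f : EuclideanSpace ℝ (Fin n) → EReal) (x₀ : EuclideanSpace ℝ (Fin n))
    (V : Submodule ℝ (EuclideanSpace ℝ (Fin n))) (ε : ℝ) (a : V) (u : Vᗮ) : EReal :=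
  ⨅ v ∈ Metric.closedBall (0 : V) ε, tiltedFun f x₀ V a u v

/-- The set `W(u; a)` of `V`-space minimizers; as usual it is empty if the infimum is `+∞`. -/
def vMinimizers (f : EuclideanSpace ℝ (Fin n) → EReal) (x₀ : EuclideanSpace ℝ (Fin n))
    (V : Submodule ℝ (EuclideanSpace ℝ (Fin n))) (ε : ℝ) (a : V) (u : Vᗮ) : Set V :=
  {v | v ∈ Metric.closedBall (0 : V) ε ∧
    tiltedFun f x₀ V a u v = uLagrangian f x₀ V ε a u ∧ uLagrangian f x₀ V ε a u ≠ ⊤}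

/-- The set `Θ` of all `u` in the open ball of radius `r` about `0` in `U` with
`|L_ε(u; a) - f(x₀)| < r`. -/
def attentiveNhd (f : EuclideanSpace ℝ (Fin n) → EReal) (x₀ : EuclideanSpace ℝ (Fin n))
    (V : Submodule ℝ (EuclideanSpace ℝ (Fin n))) (ε : ℝ) (a : V) (r : ℝ) : Set Vᗮ :=
  {u | ‖u‖ < r ∧ EClose (uLagrangian f x₀ V ε a u) (f x₀) r}

end ULagrangian

end

/-! Write `a = g_v`, `b = g_u`, `φ = f x₀` and `L` for the `U`-Lagrangian. Since `g + w` is a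
subgradient at `x₀` for every `w ∈ V` with `‖w‖ < ε`, tilting `w` towards `v` in the prox-regularity
inequality gives `f` a linear growth in `‖v‖` along `V`; it beats the quadratic error because `ρ <
2` (`tiltedFun_lower_bound`). Hence `L 0 = φ`, `b` is a regular subgradient of `L` at `0`, and when
`u` is near `0` and `L u` is not much above `φ`, every minimizer `v` is small, so it is interior to
the ball.

At an interior minimizer a regular subgradient `z` of `L` at `u` lifts to the subgradient `z + a` of
`f` at `x₀ + u + v` (`add_mem_regularSubdiff_of_uLagrangian`), and `z + a - g = z - b` is small.
Prox-regularity of `f` for `g`, tested at `x₀ + u' + v'` with `v'` a minimizer for `u'`, bounds `L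
u'` below with error `ρ/2 (‖u' - u‖² + ‖v' - v‖²)`. The Lipschitz assumption turns this into `ρ (1 +
c²)/2 ‖u' - u‖²`; where it is unavailable, `L u'` is so large that the inequality is trivial. Limits
extend the result to limiting subgradients, and adding two such inequalities gives monotonicity. -/

theorem FiniteAt.exists_coe {H : Type*} {f : H → EReal} {x : H} (h : FiniteAt f x) :
    ∃ m : ℝ, f x = m :=
  ⟨(f x).toReal, (EReal.coe_toReal h.2 h.1).symm⟩

theorem FiniteAt.of_eq_coe {H : Type*} {f : H → EReal} {x : H} {m : ℝ} (h : f x = m) :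
    FiniteAt f x :=
  ⟨h.trans_ne (EReal.coe_ne_bot m), h.trans_ne (EReal.coe_ne_top m)⟩

/-! ### Subgradient inequalities and monotonicity for general functions. -/

section VariationalAnalysis

variable {H : Type*} [NormedAddCommGroup H] [InnerProductSpace ℝ H]

theorem regularSubdiff_subset_limitingSubdiff (f : H → EReal) (x : H) :
    regularSubdiff f x ⊆ limitingSubdiff f x := fun v hv =>
  ⟨hv.1, fun _ => x, fun _ => v, tendsto_const_nhds, tendsto_const_nhds, fun _ => hv,
    tendsto_const_nhds⟩

/-- A quadratic minorant at a point with finite value gives a regular subgradient. -/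
theorem mem_regularSubdiff_of_quadratic_minorant {f : H → EReal} {x v : H} {m σ δ : ℝ}
    (hm : f x = m) (hσ : 0 ≤ σ) (hδ : 0 < δ)
    (h : ∀ y, ‖y - x‖ < δ → ((m + inner ℝ v (y - x) - σ * ‖y - x‖ ^ 2 : ℝ) : EReal) ≤ f y) :
    v ∈ regularSubdiff f x := by
  refine ⟨.of_eq_coe hm, fun η hη => ?_⟩
  -- Within this radius `σ * ‖y - x‖ ≤ η`; the `+ 1` covers `σ = 0`.
  have hpos : 0 < min δ (η / (σ + 1)) := by positivity
  filter_upwards [Metric.ball_mem_nhds x hpos] with y hy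
  rw [Metric.mem_ball, dist_eq_norm, lt_min_iff, lt_div_iff₀ (by positivity)] at hy
  refine le_trans ?_ (h y hy.1)
  rw [hm, ← EReal.coe_add, EReal.coe_le_coe_iff]
  nlinarith [norm_nonneg (y - x)]

/-- The prox-regularity inequality passes from regular to limiting subgradients. -/
theorem proxInequality_limitingSubdiff {f : H → EReal} {x₀ v₀ : H} {δ δ' σ : ℝ} {α : EReal}
    (h : ∀ x v : H, v ∈ regularSubdiff f x → ‖v - v₀‖ < δ → ‖x - x₀‖ < δ → f x < α →
      ∀ y ∈ Metric.closedBall x₀ δ',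
        f x + ((inner ℝ v (y - x) - σ / 2 * ‖y - x‖ ^ 2 : ℝ) : EReal) ≤ f y)
    {x v : H} (hv : v ∈ limitingSubdiff f x) (hvδ : ‖v - v₀‖ < δ) (hxδ : ‖x - x₀‖ < δ)
    (hα : f x < α) {y : H} (hy : y ∈ Metric.closedBall x₀ δ') :
    f x + ((inner ℝ v (y - x) - σ / 2 * ‖y - x‖ ^ 2 : ℝ) : EReal) ≤ f y := by
  obtain ⟨hfin, xk, vk, hxk, hfk, hsub, hvk⟩ := hv
  have hreal : Tendsto (fun k => inner ℝ (vk k) (y - xk k) - σ / 2 * ‖y - xk k‖ ^ 2) atTop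
      (𝓝 (inner ℝ v (y - x) - σ / 2 * ‖y - x‖ ^ 2)) :=
    (hvk.inner (tendsto_const_nhds.sub hxk)).sub
      (((tendsto_const_nhds.sub hxk).norm.pow 2).const_mul _)
  -- Addition in `EReal` is continuous here because the limit `f x` is finite.
  have hlim := (EReal.continuousAt_add (p := (f x, ((inner ℝ v (y - x)
    - σ / 2 * ‖y - x‖ ^ 2 : ℝ) : EReal))) (Or.inl hfin.2) (Or.inl hfin.1)).tendsto.comp
      (hfk.prodMk_nhds ((continuous_coe_real_ereal.tendsto _).comp hreal))
  refine le_of_tendsto hlim ?_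
  filter_upwards [(hvk.sub_const v₀).norm.eventually_lt_const hvδ,
    (hxk.sub_const x₀).norm.eventually_lt_const hxδ, hfk.eventually_lt_const hα] with k h1 h2 h3
  exact h _ _ (hsub k) h1 h2 h3 y hy

/-- Prox-regularity with constant `σ` makes `T + σ I` monotone for the attentive localizations
`T` of the subdifferential. -/
theorem ProxRegularWith.monotoneMapping {f : H → EReal} {x₀ v₀ : H} {δ σ : ℝ}
    (h : ProxRegularWith f x₀ v₀ δ σ) :
    MonotoneMapping (addScaledId (attentiveLocalization f x₀ v₀ δ) σ) := by
  rintro x₁ x₂ _ ⟨v₁, ⟨hv₁, hv₁δ, hx₁, hc₁⟩, rfl⟩ _ ⟨v₂, ⟨hv₂, hv₂δ, hx₂, hc₂⟩, rfl⟩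
  -- Each point is tested against the other; in the sum the function values cancel and the two
  -- errors `σ / 2` add up to `σ`.
  have i₁ := h.2.2.2.2 x₁ v₁ hv₁ hv₁δ hx₁ hc₁.2 x₂ (by
    rw [Metric.mem_closedBall, dist_eq_norm]; exact hx₂.le)
  have i₂ := h.2.2.2.2 x₂ v₂ hv₂ hv₂δ hx₂ hc₂.2 x₁ (by
    rw [Metric.mem_closedBall, dist_eq_norm]; exact hx₁.le)
  obtain ⟨m₁, hm₁⟩ := hv₁.1.exists_coe
  obtain ⟨m₂, hm₂⟩ := hv₂.1.exists_coe
  rw [hm₁, hm₂, ← EReal.coe_add, EReal.coe_le_coe_iff] at i₁ i₂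
  have e : v₂ + σ • x₂ - (v₁ + σ • x₁) = v₂ - v₁ + σ • (x₂ - x₁) := by
    rw [smul_sub]; abel
  have e₁ : inner ℝ v₂ (x₁ - x₂) = -inner ℝ v₂ (x₂ - x₁) := by
    rw [← inner_neg_right, neg_sub]
  rw [e₁, norm_sub_rev x₁ x₂] at i₂
  simp only [e, inner_add_left, inner_sub_left (x := v₂), real_inner_smul_left,
    real_inner_self_eq_norm_sq]
  linarith

end VariationalAnalysis

/-! ### Attainment, closedness, growth along `V`, and lifting of subgradients. -/

section ULagrangian

variable {n : ℕ} {f : EuclideanSpace ℝ (Fin n) → EReal} {x₀ : EuclideanSpace ℝ (Fin n)}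
  {V : Submodule ℝ (EuclideanSpace ℝ (Fin n))} {ε : ℝ} {a : V}

theorem uLagrangian_le_tiltedFun (u : Vᗮ) {v : V} (hv : v ∈ Metric.closedBall (0 : V) ε) :
    uLagrangian f x₀ V ε a u ≤ tiltedFun f x₀ V a u v :=
  iInf₂_le v hv

theorem tiltedFun_eq_coe_iff {u : Vᗮ} {v : V} {m : ℝ} :
    tiltedFun f x₀ V a u v = m ↔
      f (x₀ + (u : EuclideanSpace ℝ (Fin n)) + (v : EuclideanSpace ℝ (Fin n))) =
        ((m + inner ℝ a v : ℝ) : EReal) := by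
  unfold tiltedFun
  generalize f (x₀ + (u : EuclideanSpace ℝ (Fin n)) + (v : EuclideanSpace ℝ (Fin n))) = p
  induction p with
  | bot => simp [EReal.bot_ne_coe, -EReal.coe_add]
  | top => simp [EReal.top_ne_coe, -EReal.coe_add]
  | coe p =>
    rw [← EReal.coe_sub, EReal.coe_eq_coe_iff, EReal.coe_eq_coe_iff]
    constructor <;> intro h <;> linarith

theorem le_tiltedFun_iff {u : Vᗮ} {v : V} {m : ℝ} :
    (m : EReal) ≤ tiltedFun f x₀ V a u v ↔
      ((m + inner ℝ a v : ℝ) : EReal) ≤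
        f (x₀ + (u : EuclideanSpace ℝ (Fin n)) + (v : EuclideanSpace ℝ (Fin n))) := by
  unfold tiltedFun
  generalize f (x₀ + (u : EuclideanSpace ℝ (Fin n)) + (v : EuclideanSpace ℝ (Fin n))) = p
  induction p with
  | bot => simp
  | top => simp
  | coe p =>
    rw [← EReal.coe_sub, EReal.coe_le_coe_iff, EReal.coe_le_coe_iff]
    constructor <;> intro h <;> linarith

theorem lowerSemicontinuous_tiltedFun (hlsc : LowerSemicontinuous f) :
    LowerSemicontinuous fun p : Vᗮ × V => tiltedFun f x₀ V a p.1 p.2 := by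
  have h1 : LowerSemicontinuous fun p : Vᗮ × V =>
      f (x₀ + (p.1 : EuclideanSpace ℝ (Fin n)) + (p.2 : EuclideanSpace ℝ (Fin n))) :=
    hlsc.comp (g := fun p : Vᗮ × V =>
      x₀ + (p.1 : EuclideanSpace ℝ (Fin n)) + (p.2 : EuclideanSpace ℝ (Fin n))) (by fun_prop)
  have h2 : Continuous fun p : Vᗮ × V => ((-inner ℝ a p.2 : ℝ) : EReal) :=
    continuous_coe_real_ereal.comp (by fun_prop)
  have h3 := h1.add' h2.lowerSemicontinuous fun p =>
    EReal.continuousAt_add (Or.inr (EReal.coe_ne_bot _)) (Or.inr (EReal.coe_ne_top _))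
  simpa only [tiltedFun, sub_eq_add_neg, EReal.coe_neg] using h3

theorem exists_tiltedFun_eq_uLagrangian (hlsc : LowerSemicontinuous f) (hε : 0 ≤ ε) (u : Vᗮ) :
    ∃ v ∈ Metric.closedBall (0 : V) ε,
      tiltedFun f x₀ V a u v = uLagrangian f x₀ V ε a u := by
  have hl : LowerSemicontinuous fun v : V => tiltedFun f x₀ V a u v :=
    (lowerSemicontinuous_tiltedFun hlsc).comp (g := fun v : V => (u, v)) (by fun_prop)
  obtain ⟨v, hv, hmin⟩ := LowerSemicontinuousOn.exists_isMinOn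
    (s := Metric.closedBall (0 : V) ε) ⟨0, by simpa using hε⟩ (isCompact_closedBall _ _)
    (hl.lowerSemicontinuousOn _)
  exact ⟨v, hv, le_antisymm (le_iInf₂ fun w hw => hmin hw) (uLagrangian_le_tiltedFun u hv)⟩

theorem uLagrangian_ne_bot (hbot : ∀ x, f x ≠ ⊥) (hlsc : LowerSemicontinuous f) (hε : 0 ≤ ε)
    (u : Vᗮ) : uLagrangian f x₀ V ε a u ≠ ⊥ := by
  obtain ⟨v, -, hv⟩ := exists_tiltedFun_eq_uLagrangian (x₀ := x₀) (a := a) hlsc hε u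
  rw [← hv, tiltedFun, sub_eq_add_neg, ← EReal.coe_neg]
  exact EReal.add_ne_bot_iff.2 ⟨hbot _, EReal.coe_ne_bot _⟩

/-- As the infimum is attained, the set is the projection of a compact sublevel set in `Vᗮ × V`. -/
theorem isClosed_uLagrangian_sublevel (hlsc : LowerSemicontinuous f) (hε : 0 ≤ ε)
    (δ : ℝ) (α : EReal) :
    IsClosed {u : Vᗮ | u ∈ Metric.closedBall 0 δ ∧ uLagrangian f x₀ V ε a u ≤ α} := by
  have hK : IsCompact (Metric.closedBall (0 : Vᗮ) δ ×ˢ Metric.closedBall (0 : V) ε ∩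
      (fun p : Vᗮ × V => tiltedFun f x₀ V a p.1 p.2) ⁻¹' Set.Iic α) :=
    ((isCompact_closedBall _ _).prod (isCompact_closedBall _ _)).inter_right
      ((lowerSemicontinuous_tiltedFun hlsc).isClosed_preimage α)
  convert (hK.image continuous_fst).isClosed using 1
  ext u
  constructor
  · rintro ⟨hu, hα⟩
    obtain ⟨v, hv, hmin⟩ := exists_tiltedFun_eq_uLagrangian (x₀ := x₀) (a := a) hlsc hε u
    exact ⟨(u, v), ⟨⟨hu, hv⟩, hmin.trans_le hα⟩, rfl⟩
  · rintro ⟨⟨u, v⟩, ⟨⟨hu, hv⟩, hα⟩, rfl⟩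
    exact ⟨hu, (uLagrangian_le_tiltedFun u hv).trans hα⟩

/-- The decomposition of inner products along `V` and its orthogonal complement. -/
theorem inner_orthogonal_decomposition (g : EuclideanSpace ℝ (Fin n)) (u : Vᗮ) (v : V) :
    inner ℝ g ((u : EuclideanSpace ℝ (Fin n)) + (v : EuclideanSpace ℝ (Fin n))) =
      inner ℝ (Vᗮ.orthogonalProjectionOnto g) u + inner ℝ (V.orthogonalProjectionOnto g) v := by
  rw [inner_add_right, Submodule.inner_orthogonalProjectionOnto_eq_of_mem_right,
    Submodule.inner_orthogonalProjectionOnto_eq_of_mem_right]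

theorem norm_sq_orthogonal_add (u : Vᗮ) (v : V) :
    ‖(u : EuclideanSpace ℝ (Fin n)) + (v : EuclideanSpace ℝ (Fin n))‖ ^ 2 =
      ‖u‖ ^ 2 + ‖v‖ ^ 2 := by
  have h : inner ℝ (u : EuclideanSpace ℝ (Fin n)) (v : EuclideanSpace ℝ (Fin n)) = 0 :=
    Submodule.inner_left_of_mem_orthogonal v.2 u.2
  rw [norm_add_sq_real, h]
  simp

/-- The sharp growth of `f` along `V`, uniform in small displacements along `Vᗮ`. -/
theorem tiltedFun_lower_bound {εbar ρ φ : ℝ} {g : EuclideanSpace ℝ (Fin n)}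
    (hε : 0 < ε) (hg : g ∈ subgradCore f x₀ V ε)
    (hprox : ∀ g ∈ limitingSubdiff f x₀, ProxRegularWith f x₀ g εbar ρ) (hφ : f x₀ = φ)
    (hρ₀ : 0 < ρ) (hρ₂ : ρ < 2) {u : Vᗮ} {v : V}
    (hu : ‖u‖ + ε ≤ εbar) (hv : ‖v‖ ≤ ε) :
    ((φ + inner ℝ (Vᗮ.orthogonalProjectionOnto g) u - ρ / 2 * ‖u‖ ^ 2
        + (1 - ρ / 2) / 2 * ε * ‖v‖ : ℝ) : EReal) ≤
      tiltedFun f x₀ V (V.orthogonalProjectionOnto g) u v := by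
  -- The midpoint of `ρ / 2` and `1`: `t < 1` keeps `‖w‖ < ε`, and `t - ρ / 2 = (1 - ρ / 2) / 2` is
  -- the growth rate left. For `v = 0` the convention `0⁻¹ = 0` gives `w = 0`.
  set t : ℝ := (1 + ρ / 2) / 2 with ht
  have hεbar : 0 < εbar := by linarith [norm_nonneg u]
  set w : V := (t * ε * ‖v‖⁻¹) • v with hw
  have hwn : ‖w‖ < ε := by
    rw [hw, norm_smul, Real.norm_of_nonneg (by positivity), mul_assoc]
    have h1 : ‖v‖⁻¹ * ‖v‖ ≤ 1 := inv_mul_le_one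
    nlinarith [mul_nonneg (show 0 ≤ t * ε by positivity) (sub_nonneg.2 h1)]
  have hwv : inner ℝ w v = t * ε * ‖v‖ := by
    rw [hw, Submodule.coe_inner, Submodule.coe_smul, real_inner_smul_left, ← Submodule.coe_inner,
      real_inner_self_eq_norm_sq]
    rcases eq_or_ne ‖v‖ 0 with h | h
    · simp [h]
    · field_simp
  have hmem := hg w w.2 hwn
  have hball : x₀ + (u : EuclideanSpace ℝ (Fin n)) + (v : EuclideanSpace ℝ (Fin n)) ∈
      Metric.closedBall x₀ εbar := by
    rw [Metric.mem_closedBall, dist_eq_norm, add_assoc, add_sub_cancel_left]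
    refine (norm_add_le _ _).trans ?_
    simp only [Submodule.coe_norm] at hu hv ⊢
    linarith
  have key := (hprox _ hmem).2.2.2.2 x₀ _ hmem (by simpa using hεbar) (by simpa using hεbar)
    (by rw [hφ, ← EReal.coe_add, EReal.coe_lt_coe_iff]; linarith) _ hball
  rw [le_tiltedFun_iff]
  refine le_trans ?_ key
  have hi : inner ℝ (w : EuclideanSpace ℝ (Fin n))
      ((u : EuclideanSpace ℝ (Fin n)) + (v : EuclideanSpace ℝ (Fin n))) = t * ε * ‖v‖ := by
    rw [inner_add_right, Submodule.inner_right_of_mem_orthogonal w.2 u.2, zero_add, ← hwv]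
    rfl
  rw [hφ, ← EReal.coe_add, EReal.coe_le_coe_iff, add_assoc x₀, add_sub_cancel_left,
    inner_add_left, hi, inner_orthogonal_decomposition, norm_sq_orthogonal_add]
  -- The quadratic error is absorbed through `‖v‖ ^ 2 ≤ ε * ‖v‖`.
  nlinarith [mul_nonneg (norm_nonneg v) (sub_nonneg.2 hv)]

/-- A regular subgradient of the `U`-Lagrangian lifts to a regular subgradient of `f` at every
minimizer in the interior of the ball. -/
theorem add_mem_regularSubdiff_of_uLagrangian {u z : Vᗮ} {v : V} (hv : ‖v‖ < ε)
    (hmin : tiltedFun f x₀ V a u v = uLagrangian f x₀ V ε a u)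
    (hz : z ∈ regularSubdiff (uLagrangian f x₀ V ε a) u) :
    (z : EuclideanSpace ℝ (Fin n)) + (a : EuclideanSpace ℝ (Fin n)) ∈ regularSubdiff f
      (x₀ + (u : EuclideanSpace ℝ (Fin n)) + (v : EuclideanSpace ℝ (Fin n))) := by
  obtain ⟨hfin, hz⟩ := hz
  obtain ⟨m, hm⟩ := hfin.exists_coe
  rw [hm, tiltedFun_eq_coe_iff] at hmin
  refine ⟨.of_eq_coe hmin, fun η hη => ?_⟩
  set x := x₀ + (u : EuclideanSpace ℝ (Fin n)) + (v : EuclideanSpace ℝ (Fin n)) with hx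
  have hPu : Vᗮ.orthogonalProjectionOnto (x - x₀) = u := by
    rw [hx, add_assoc, add_sub_cancel_left, map_add,
      Submodule.orthogonalProjectionOnto_mem_subspace_eq_self,
      Submodule.orthogonalProjectionOnto_orthogonal_apply_eq_zero v.2, add_zero]
  have hPv : V.orthogonalProjectionOnto (x - x₀) = v := by
    rw [hx, add_assoc, add_sub_cancel_left, map_add,
      Submodule.orthogonalProjectionOnto_mem_subspace_eq_self,
      Submodule.orthogonalProjectionOnto_apply_of_mem_orthogonal u.2, zero_add]
  have hcu : Tendsto (fun y => Vᗮ.orthogonalProjectionOnto (y - x₀)) (𝓝 x) (𝓝 u) := by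
    have : Continuous fun y => Vᗮ.orthogonalProjectionOnto (y - x₀) := by fun_prop
    simpa only [hPu] using this.tendsto x
  have hcv : Tendsto (fun y => ‖V.orthogonalProjectionOnto (y - x₀)‖) (𝓝 x) (𝓝 ‖v‖) := by
    have : Continuous fun y => ‖V.orthogonalProjectionOnto (y - x₀)‖ := by fun_prop
    simpa only [hPv] using this.tendsto x
  -- Interiority of `v` keeps the `V`-component of nearby `y` feasible, so `L` at the `U`-component
  -- bounds the tilted value at `y` from below.
  filter_upwards [hcu.eventually (hz η hη), hcv.eventually_lt_const hv] with y hy1 hy2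
  set u' := Vᗮ.orthogonalProjectionOnto (y - x₀) with hu'
  set v' := V.orthogonalProjectionOnto (y - x₀) with hv'
  have hdec : y = x₀ + (u' : EuclideanSpace ℝ (Fin n)) + (v' : EuclideanSpace ℝ (Fin n)) := by
    have h := V.starProjection_add_starProjection_orthogonal (y - x₀)
    rw [Submodule.starProjection_apply, Submodule.starProjection_apply] at h
    rw [add_assoc, add_comm (u' : EuclideanSpace ℝ (Fin n)), hu', hv', h]
    abel
  have hle := hy1.trans (uLagrangian_le_tiltedFun (f := f) (x₀ := x₀) (a := a) u' (v := v')
    (by simpa using hy2.le))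
  rw [hm, ← EReal.coe_add, le_tiltedFun_iff, ← hdec] at hle
  refine le_trans ?_ hle
  have hdiff : y - x = ((u' - u : Vᗮ) : EuclideanSpace ℝ (Fin n)) +
      ((v' - v : V) : EuclideanSpace ℝ (Fin n)) := by
    rw [hdec, hx]; push_cast; abel
  have hnorm : ‖u' - u‖ ≤ ‖y - x‖ := by
    refine le_of_sq_le_sq ?_ (norm_nonneg _)
    rw [hdiff, norm_sq_orthogonal_add]
    nlinarith [sq_nonneg ‖v' - v‖]
  have hinner : inner ℝ ((z : EuclideanSpace ℝ (Fin n)) + (a : EuclideanSpace ℝ (Fin n))) (y - x)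
      = inner ℝ z (u' - u) + (inner ℝ a v' - inner ℝ a v) := by
    rw [hdiff, inner_add_left, inner_add_right, inner_add_right,
      Submodule.inner_left_of_mem_orthogonal (v' - v).2 z.2,
      Submodule.inner_right_of_mem_orthogonal a.2 (u' - u).2, ← inner_sub_right]
    simp [Submodule.coe_inner]
  rw [hmin, hinner, ← EReal.coe_add, EReal.coe_le_coe_iff]
  nlinarith

end ULagrangian

/-! ### Prox-regularity of the `U`-Lagrangian. -/

section ULagrangian

variable {n : ℕ} {f : EuclideanSpace ℝ (Fin n) → EReal} {x₀ : EuclideanSpace ℝ (Fin n)}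
  {V : Submodule ℝ (EuclideanSpace ℝ (Fin n))} {ε εbar ρ φ : ℝ} {g : EuclideanSpace ℝ (Fin n)}

theorem uLagrangian_lower_bound (hε : 0 < ε) (hg : g ∈ subgradCore f x₀ V ε)
    (hprox : ∀ g ∈ limitingSubdiff f x₀, ProxRegularWith f x₀ g εbar ρ) (hφ : f x₀ = φ)
    (hρ₀ : 0 < ρ) (hρ₂ : ρ < 2) {u : Vᗮ} (hu : ‖u‖ + ε ≤ εbar) :
    ((φ + inner ℝ (Vᗮ.orthogonalProjectionOnto g) u - ρ / 2 * ‖u‖ ^ 2 : ℝ) : EReal) ≤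
      uLagrangian f x₀ V ε (V.orthogonalProjectionOnto g) u := by
  refine le_iInf₂ fun v hv => le_trans ?_
    (tiltedFun_lower_bound hε hg hprox hφ hρ₀ hρ₂ hu (by simpa using hv))
  rw [EReal.coe_le_coe_iff]
  have : 0 ≤ (1 - ρ / 2) / 2 * ε * ‖v‖ :=
    mul_nonneg (mul_nonneg (by linarith) hε.le) (norm_nonneg v)
  linarith

theorem uLagrangian_zero (hε : 0 < ε) (hg : g ∈ subgradCore f x₀ V ε)
    (hprox : ∀ g ∈ limitingSubdiff f x₀, ProxRegularWith f x₀ g εbar ρ) (hφ : f x₀ = φ)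
    (hρ₀ : 0 < ρ) (hρ₂ : ρ < 2) (hεbar : ε ≤ εbar) :
    uLagrangian f x₀ V ε (V.orthogonalProjectionOnto g) 0 = φ := by
  apply le_antisymm
  · refine (uLagrangian_le_tiltedFun 0 (v := 0) (by simpa using hε.le)).trans_eq ?_
    rw [tiltedFun_eq_coe_iff]
    simp [hφ]
  · simpa using uLagrangian_lower_bound (u := 0) hε hg hprox hφ hρ₀ hρ₂ (by simpa using hεbar)

/-- At a regular subgradient of the `U`-Lagrangian, the prox-regularity inequality of `f` at a
minimizer gives an inequality between values of the `U`-Lagrangian that involves the distance of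
the minimizers. -/
theorem uLagrangian_proxInequality {a : V} {u z u' : Vᗮ} {v v' : V} {m : ℝ} (hφ : f x₀ = φ)
    (hfin : uLagrangian f x₀ V ε a u = m)
    (hz : z ∈ regularSubdiff (uLagrangian f x₀ V ε a) u) (hv : ‖v‖ < ε)
    (hmin : tiltedFun f x₀ V a u v = uLagrangian f x₀ V ε a u)
    (hprox : ProxRegularWith f x₀ g εbar ρ)
    (ha : V.orthogonalProjectionOnto g = a)
    (hzg : ‖z - Vᗮ.orthogonalProjectionOnto g‖ < εbar) (huv : ‖u‖ + ‖v‖ < εbar)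
    (hm : m + inner ℝ a v < φ + εbar) (huv' : ‖u'‖ + ‖v'‖ ≤ εbar) :
    ((m + inner ℝ z (u' - u) - ρ / 2 * (‖u' - u‖ ^ 2 + ‖v' - v‖ ^ 2) : ℝ) : EReal) ≤
      tiltedFun f x₀ V a u' v' := by
  have hmem := regularSubdiff_subset_limitingSubdiff _ _
    (add_mem_regularSubdiff_of_uLagrangian hv hmin hz)
  rw [hfin, tiltedFun_eq_coe_iff] at hmin
  have hd1 : (z : EuclideanSpace ℝ (Fin n)) + (a : EuclideanSpace ℝ (Fin n)) - g =
      ((z - Vᗮ.orthogonalProjectionOnto g : Vᗮ) : EuclideanSpace ℝ (Fin n)) := by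
    have h := V.starProjection_add_starProjection_orthogonal g
    rw [Submodule.starProjection_apply, Submodule.starProjection_apply, ha] at h
    nth_rewrite 1 [← h]
    push_cast
    abel
  have hd2 : x₀ + (u' : EuclideanSpace ℝ (Fin n)) + (v' : EuclideanSpace ℝ (Fin n)) -
      (x₀ + (u : EuclideanSpace ℝ (Fin n)) + (v : EuclideanSpace ℝ (Fin n))) =
      ((u' - u : Vᗮ) : EuclideanSpace ℝ (Fin n)) +
        ((v' - v : V) : EuclideanSpace ℝ (Fin n)) := by
    push_cast; abel
  have key := hprox.2.2.2.2 _ _ hmem (by rw [hd1]; exact hzg)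
    (by
      rw [add_assoc, add_sub_cancel_left]
      exact (norm_add_le _ _).trans_lt huv)
    (by rw [hmin, hφ, ← EReal.coe_add, EReal.coe_lt_coe_iff]; exact hm)
    (x₀ + (u' : EuclideanSpace ℝ (Fin n)) + (v' : EuclideanSpace ℝ (Fin n)))
    (by
      rw [Metric.mem_closedBall, dist_eq_norm, add_assoc, add_sub_cancel_left]
      exact (norm_add_le _ _).trans huv')
  rw [le_tiltedFun_iff]
  refine le_trans (le_of_eq ?_) key
  have hinner : inner ℝ ((z : EuclideanSpace ℝ (Fin n)) + (a : EuclideanSpace ℝ (Fin n)))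
      (((u' - u : Vᗮ) : EuclideanSpace ℝ (Fin n)) +
        ((v' - v : V) : EuclideanSpace ℝ (Fin n)))
      = inner ℝ z (u' - u) + (inner ℝ a v' - inner ℝ a v) := by
    rw [inner_add_left, inner_add_right, inner_add_right,
      Submodule.inner_left_of_mem_orthogonal (v' - v).2 z.2,
      Submodule.inner_right_of_mem_orthogonal a.2 (u' - u).2, ← inner_sub_right]
    simp [Submodule.coe_inner]
  rw [hmin, hd2, hinner, norm_sq_orthogonal_add, ← EReal.coe_add, EReal.coe_eq_coe_iff]
  ring

theorem exists_pos_mul_le (C μ : ℝ) (hC : 0 ≤ C) (hμ : 0 < μ) :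
    ∃ δ : ℝ, 0 < δ ∧ δ ≤ 1 ∧ δ * C < μ := by
  refine ⟨min 1 (μ / (C + 1)), by positivity, min_le_left _ _, ?_⟩
  have h : min 1 (μ / (C + 1)) * (C + 1) ≤ μ :=
    (le_div_iff₀ (by positivity)).1 (min_le_right _ _)
  have h' : 0 < min 1 (μ / (C + 1)) := by positivity
  linarith

/-- Prox-regularity of the `U`-Lagrangian, with the constant `ρ * (1 + c ^ 2)`. -/
theorem exists_proxRegularWith_uLagrangian {r c : ℝ} (hε : 0 < ε)
    (hg : g ∈ subgradCore f x₀ V ε) (hbot : ∀ x, f x ≠ ⊥) (hlsc : LowerSemicontinuous f)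
    (hprox : ∀ g ∈ limitingSubdiff f x₀, ProxRegularWith f x₀ g εbar ρ)
    (hρ₀ : 0 < ρ) (hρ₂ : ρ < 2) (hεbar : ε < εbar) (hr : 0 < r)
    (hLip : ∀ u₁ ∈ attentiveNhd f x₀ V ε (V.orthogonalProjectionOnto g) r,
      ∀ u₂ ∈ attentiveNhd f x₀ V ε (V.orthogonalProjectionOnto g) r,
      ∀ v₁ ∈ vMinimizers f x₀ V ε (V.orthogonalProjectionOnto g) u₁,
      ∀ v₂ ∈ vMinimizers f x₀ V ε (V.orthogonalProjectionOnto g) u₂,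
        ‖v₁ - v₂‖ ≤ c * ‖u₁ - u₂‖) :
    ∃ δ : ℝ, ProxRegularWith (uLagrangian f x₀ V ε (V.orthogonalProjectionOnto g)) 0
      (Vᗮ.orthogonalProjectionOnto g) δ (ρ * (1 + c ^ 2)) := by
  have hgmem : g ∈ limitingSubdiff f x₀ := by
    simpa using hg 0 V.zero_mem (by simpa using hε)
  obtain ⟨φ, hφ⟩ := hgmem.1.exists_coe
  set a := V.orthogonalProjectionOnto g with ha
  set b := Vᗮ.orthogonalProjectionOnto g with hb
  set L := uLagrangian f x₀ V ε a with hL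
  have hL0 : L 0 = φ := uLagrangian_zero hε hg hprox hφ hρ₀ hρ₂ hεbar.le
  have hLbot : ∀ u, L u ≠ ⊥ := uLagrangian_ne_bot hbot hlsc hε.le
  set κ : ℝ := (1 - ρ / 2) / 2 * ε with hκ
  have hκ0 : 0 < κ := mul_pos (by linarith) hε
  -- Growth at rate `κ` against `L u < φ + δ` and `‖u‖ < δ ≤ 1` yields `κ * ‖v‖ ≤ δ * (2 + ‖b‖)`.
  set M : ℝ := (2 + ‖b‖) / κ with hM
  have hM0 : 0 ≤ M := by positivity
  -- The terms with `M` make minimizers interior and keep the lifted points and values within the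
  -- range of prox-regularity of `f`; `2 * ‖b‖ + 3` serves the case `φ + r ≤ L u'`.
  obtain ⟨δ, hδ0, hδ1, hδ⟩ := exists_pos_mul_le (1 + (1 + ‖a‖) * M + (2 * ‖b‖ + 3))
    (min (min (εbar - ε) ε) r) (by positivity)
    (lt_min (lt_min (sub_pos.2 hεbar) hε) hr)
  rw [lt_min_iff, lt_min_iff] at hδ
  obtain ⟨⟨hδ₁, hδ₂⟩, hδr⟩ := hδ
  have pM : 0 ≤ δ * M := by positivity
  have paM : 0 ≤ δ * (‖a‖ * M) := by positivity
  have pb : 0 ≤ δ * ‖b‖ := by positivity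
  have hlow : ∀ u : Vᗮ, ‖u‖ ≤ δ → ((φ - δ * (‖b‖ + 1) : ℝ) : EReal) ≤ L u := fun u hu => by
    refine le_trans ?_ (uLagrangian_lower_bound (u := u) hε hg hprox hφ hρ₀ hρ₂ (by linarith))
    rw [EReal.coe_le_coe_iff]
    have h1 := neg_le_of_abs_le (abs_real_inner_le_norm b u)
    have h2 : ‖b‖ * ‖u‖ ≤ ‖b‖ * δ := mul_le_mul_of_nonneg_left hu (norm_nonneg _)
    have h3 : ‖u‖ ^ 2 ≤ δ := by nlinarith [norm_nonneg u]
    nlinarith [sq_nonneg ‖u‖]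
  have hbL : b ∈ regularSubdiff L 0 := by
    refine mem_regularSubdiff_of_quadratic_minorant hL0 (half_pos hρ₀).le
      (sub_pos.2 hεbar) fun u hu => ?_
    simp only [sub_zero] at hu ⊢
    exact uLagrangian_lower_bound hε hg hprox hφ hρ₀ hρ₂ (by linarith)
  refine ⟨δ, hδ0, by positivity, ⟨.of_eq_coe hL0, 1, one_pos, fun α _ =>
    isClosed_uLagrangian_sublevel hlsc hε.le _ _⟩,
    regularSubdiff_subset_limitingSubdiff _ _ hbL, fun x z hz hzb hx hLx y hy =>
    proxInequality_limitingSubdiff ?_ hz hzb hx hLx hy⟩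
  clear! x y z
  intro u z hz hzb hu hLu u' hu'
  rw [sub_zero] at hu
  rw [mem_closedBall_zero_iff] at hu'
  obtain ⟨m, hm⟩ := hz.1.exists_coe
  obtain ⟨v, hvε, hv⟩ := exists_tiltedFun_eq_uLagrangian (x₀ := x₀) (a := a) hlsc hε.le u
  obtain ⟨v', hv'ε, hv'⟩ := exists_tiltedFun_eq_uLagrangian (x₀ := x₀) (a := a) hlsc hε.le u'
  rw [mem_closedBall_zero_iff] at hvε hv'ε
  rw [hm, hL0, ← EReal.coe_add, EReal.coe_lt_coe_iff] at hLu
  rcases eq_or_ne (L u') ⊤ with htop | htop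
  · rw [htop]; exact le_top
  obtain ⟨s, hs⟩ := FiniteAt.exists_coe ⟨hLbot u', htop⟩
  have hvM : ‖v‖ ≤ δ * M := by
    have h := tiltedFun_lower_bound (u := u) (v := v) hε hg hprox hφ hρ₀ hρ₂ (by linarith) hvε
    rw [← ha, hv, ← hL, hm, EReal.coe_le_coe_iff, ← hκ, ← hb] at h
    have h1 := neg_le_of_abs_le (abs_real_inner_le_norm b u)
    have h2 : ‖b‖ * ‖u‖ ≤ ‖b‖ * δ := mul_le_mul_of_nonneg_left hu.le (norm_nonneg _)
    have h3 : ‖u‖ ^ 2 ≤ δ := by nlinarith [norm_nonneg u]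
    have h4 : ρ / 2 * ‖u‖ ^ 2 ≤ δ := by nlinarith [sq_nonneg ‖u‖]
    rw [hM, mul_div_assoc', le_div_iff₀ hκ0]
    linarith
  have hav : inner ℝ a v ≤ ‖a‖ * (δ * M) :=
    (real_inner_le_norm a v).trans (mul_le_mul_of_nonneg_left hvM (norm_nonneg _))
  have key := uLagrangian_proxInequality (v' := v') (u' := u') hφ hm hz (by linarith) hv
    (hprox g hgmem) ha.symm (by linarith) (by linarith) (by linarith) (by linarith)
  rw [hv', ← hL, hs, EReal.coe_le_coe_iff] at key
  have huΘ : u ∈ attentiveNhd f x₀ V ε a r := by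
    refine ⟨by linarith, ?_, ?_⟩
    · refine lt_of_lt_of_le ?_ (hlow u hu.le)
      rw [hφ, ← EReal.coe_sub, EReal.coe_lt_coe_iff]
      linarith
    · rw [← hL, hm, hφ, ← EReal.coe_add, EReal.coe_lt_coe_iff]
      linarith
  rw [hm, hs, ← EReal.coe_add, EReal.coe_le_coe_iff]
  -- The lower half of the closeness condition at `u'` follows from `hlow`, so only the upper half
  -- can fail.
  rcases lt_or_ge s (φ + r) with hsr | hsr
  · have hu'Θ : u' ∈ attentiveNhd f x₀ V ε a r := by
      refine ⟨by linarith, ?_, ?_⟩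
      · refine lt_of_lt_of_le ?_ (hlow u' hu')
        rw [hφ, ← EReal.coe_sub, EReal.coe_lt_coe_iff]
        linarith
      · rw [← hL, hs, hφ, ← EReal.coe_add, EReal.coe_lt_coe_iff]
        exact hsr
    have hvv := hLip u' hu'Θ u huΘ v'
      ⟨mem_closedBall_zero_iff.2 hv'ε, hv', htop⟩ v
      ⟨mem_closedBall_zero_iff.2 hvε, hv, hz.1.2⟩
    have hsq : ‖v' - v‖ ^ 2 ≤ c ^ 2 * ‖u' - u‖ ^ 2 := by
      rw [← mul_pow]
      exact pow_le_pow_left₀ (norm_nonneg _) hvv 2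
    have h1 : ρ / 2 * ‖v' - v‖ ^ 2 ≤ ρ / 2 * (c ^ 2 * ‖u' - u‖ ^ 2) :=
      mul_le_mul_of_nonneg_left hsq (half_pos hρ₀).le
    linarith
  -- Here the left side is below `φ + δ + 2 * δ * (‖b‖ + 1) = φ + δ * (2 * ‖b‖ + 3) < φ + r ≤ s`,
  -- whatever the minimizers are.
  · have hzn : ‖z‖ ≤ ‖b‖ + 1 := by
      have := norm_le_norm_add_norm_sub' z b
      linarith
    have hun : ‖u' - u‖ ≤ 2 * δ := (norm_sub_le _ _).trans (by linarith)
    have h1 : inner ℝ z (u' - u) ≤ (‖b‖ + 1) * (2 * δ) :=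
      (real_inner_le_norm _ _).trans (mul_le_mul hzn hun (norm_nonneg _) (by positivity))
    have h2 : 0 ≤ ρ * (1 + c ^ 2) / 2 * ‖u' - u‖ ^ 2 := by positivity
    linarith

end ULagrangian

theorem mainTheorem2 {n : ℕ} (f : EuclideanSpace ℝ (Fin n) → EReal)
    (x₀ : EuclideanSpace ℝ (Fin n)) (V : Submodule ℝ (EuclideanSpace ℝ (Fin n)))
    (ε εbar ρ c : ℝ) (g : EuclideanSpace ℝ (Fin n))
    (hε : 0 < ε) (hg : g ∈ subgradCore f x₀ V ε)
    -- first assumption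
    (hproper : IsProperFun f) (hlsc : LowerSemicontinuous f)
    (hprox : ProperlyProxRegularWith f x₀ εbar ρ)
    -- second assumption
    (hρ₀ : 0 < ρ) (hρ₂ : ρ < 2) (hεbar : ε < εbar)
    -- third assumption
    (hc : 0 ≤ c)
    (hLip : ∀ u₁ ∈ attentiveNhd f x₀ V ε (V.orthogonalProjectionOnto g) (√(εbar - ε)),
      ∀ u₂ ∈ attentiveNhd f x₀ V ε (V.orthogonalProjectionOnto g) (√(εbar - ε)),
      ∀ v₁ ∈ vMinimizers f x₀ V ε (V.orthogonalProjectionOnto g) u₁,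
      ∀ v₂ ∈ vMinimizers f x₀ V ε (V.orthogonalProjectionOnto g) u₂,
        ‖v₁ - v₂‖ ≤ c * ‖u₁ - u₂‖) :
    ProxRegular (uLagrangian f x₀ V ε (V.orthogonalProjectionOnto g)) 0
        (Vᗮ.orthogonalProjectionOnto g) ∧
    ∃ δ : ℝ, 0 < δ ∧ MonotoneMapping
      (addScaledId
        (attentiveLocalization (uLagrangian f x₀ V ε (V.orthogonalProjectionOnto g)) 0
          (Vᗮ.orthogonalProjectionOnto g) δ)
        (ρ * (1 + c ^ 2))) := by

  obtain ⟨δ, h⟩ := exists_proxRegularWith_uLagrangian hε hg hproper.1 hlsc hprox.1 hρ₀ hρ₂ hεbar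
    (Real.sqrt_pos.2 (sub_pos.2 hεbar)) hLip
  exact ⟨⟨δ, _, h⟩, δ, h.1, h.monotoneMapping⟩
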